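/- For every $\gamma\ge 0$ there exist a complete probability space $(\Omega,\mathcal F,P)$ with a filtration $(\mathcal F_t)_{t\ge 0}$ satisfying the usual conditions (right-continuity, and $\mathcal F_0$ contains all events of probability zero) and, on it, a real-valued semimartingale $Y=(Y_t)_{t\ge 0}$ (the sum of a cadlag local martingale and a cadlag adapted process of locally finite variation) with $Y_0=0$, together with constants $\mu\ge 0$ and $\sigma^2>0$ with $\gamma=\mu/\sigma^2$ (so $\mu>0$ when $\gamma>0$), such that both $(Y_t+\mu t)_{t\ge 0}$ and $([Y,Y]_t-\sigma^2t)_{t\ge 0}$ are supermartingales and, with $Y^*=\sup\{Y_t: t\ge 0\}\in[0,\infty]$, $$P\{Y^*\ge a\}\ \ge\ \frac{1}{5(1+\gamma a)}\qquad\text{for all } a\ge 0 .$$ In particular, $E[Y^*]=+\infty$ for this $Y$. Here $[Y,Y]$ is the quadratic variation process of $Y$: the nondecreasing cadlag process such that, for every $t\ge0$, $[Y,Y]_t$ is the limit in probability of $\sum_i (Y_{t_{i+1}}-Y_{t_i})^2$ along every sequence of partitions $0=t_0<t_1<\dots<t_k=t$ of $[0,t]$ whose mesh tends to $0$. -/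

import Mathlib

open MeasureTheory ProbabilityTheory Filter Topology
open scoped NNReal ENNReal

/-- The usual conditions for a filtered probability space in continuous time: the probability
space is complete, the filtration is right-continuous, and `𝓕 0` (hence every `𝓕 t`) contains
all events of probability zero. -/
structure UsualConditions {Ω : Type*} {m : MeasurableSpace Ω} (𝓕 : Filtration ℝ≥0 m)
    (P : Measure Ω) : Prop where
  complete : P.IsComplete
  rightCont : 𝓕.IsRightContinuous
  null_mem : ∀ s : Set Ω, P s = 0 → MeasurableSet[𝓕 0] s

/-- A path is cadlag if it is right-continuous with finite left limits. -/
def IsCadlagPath (f : ℝ≥0 → ℝ) : Prop :=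
  ∀ t, ContinuousWithinAt f (Set.Ici t) t ∧ ∃ l : ℝ, Tendsto f (𝓝[<] t) (𝓝 l)

/-- Cadlag local martingales. -/
def IsCadlagLocalMartingale {Ω : Type*} {m : MeasurableSpace Ω} (M : ℝ≥0 → Ω → ℝ)
    (𝓕 : Filtration ℝ≥0 m) (P : Measure Ω) : Prop :=
  (∀ ω, IsCadlagPath (fun t => M t ω)) ∧ StronglyAdapted 𝓕 M ∧
    Locally (fun Z => Martingale Z 𝓕 P) 𝓕 M P

/-- Cadlag, adapted processes of locally finite variation. -/
def IsCadlagFiniteVariation {Ω : Type*} {m : MeasurableSpace Ω} (A : ℝ≥0 → Ω → ℝ)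
    (𝓕 : Filtration ℝ≥0 m) : Prop :=
  (∀ ω, IsCadlagPath (fun t => A t ω)) ∧ StronglyAdapted 𝓕 A ∧
    ∀ ω, LocallyBoundedVariationOn (fun t => A t ω) Set.univ

/-- Semimartingales: sums of a cadlag local martingale and a cadlag, adapted process of locally
finite variation. -/
def IsSemimartingale {Ω : Type*} {m : MeasurableSpace Ω} (Y : ℝ≥0 → Ω → ℝ)
    (𝓕 : Filtration ℝ≥0 m) (P : Measure Ω) : Prop :=
  ∃ M A : ℝ≥0 → Ω → ℝ, IsCadlagLocalMartingale M 𝓕 P ∧ IsCadlagFiniteVariation A 𝓕 ∧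
    ∀ t ω, Y t ω = M t ω + A t ω

/-- `τ n 0 < τ n 1 < ⋯ < τ n (k n)` is, for each `n`, a partition of `[0, t]`, and the mesh of
these partitions tends to zero as `n → ∞`. -/
structure IsPartitionSeq (t : ℝ≥0) (k : ℕ → ℕ) (τ : ℕ → ℕ → ℝ≥0) : Prop where
  first : ∀ n, τ n 0 = 0
  last : ∀ n, τ n (k n) = t
  lt_succ : ∀ n, ∀ i < k n, τ n i < τ n (i + 1)
  mesh : ∀ ε : ℝ, 0 < ε → ∀ᶠ n in atTop, ∀ i < k n, ((τ n (i + 1) : ℝ) - (τ n i : ℝ)) < ε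

/-- `Q` is (a version of) the quadratic variation process `[Y, Y]`: it has nondecreasing cadlag
paths and, for every `t` and every sequence of partitions of `[0, t]` whose mesh tends to zero,
`Q t` is the limit in probability of the sums of squared increments of `Y`. -/
structure IsQuadraticVariation {Ω : Type*} {m : MeasurableSpace Ω} (Y Q : ℝ≥0 → Ω → ℝ)
    (P : Measure Ω) : Prop where
  mono : ∀ ω, Monotone (fun t => Q t ω)
  cadlag : ∀ ω, IsCadlagPath (fun t => Q t ω)
  tendsto : ∀ (t : ℝ≥0) (k : ℕ → ℕ) (τ : ℕ → ℕ → ℝ≥0), IsPartitionSeq t k τ →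
    TendstoInMeasure P
      (fun n ω => ∑ i ∈ Finset.range (k n), (Y (τ n (i + 1)) ω - Y (τ n i) ω) ^ 2)
      atTop (Q t)

/-- `Y` is a semimartingale with `Y 0 = 0`, and there are `μ ≥ 0` and `σ² > 0` with `γ = μ / σ²`
such that `Y t + μ t` and `[Y, Y] t - σ² t` are supermartingales. (For `γ > 0`, the identity
`γ = μ / σ²` forces `μ > 0`; for `γ = 0` it forces `μ = 0`.) -/
def TimedDriftDown {Ω : Type*} {m : MeasurableSpace Ω} (Y : ℝ≥0 → Ω → ℝ) (γ : ℝ)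
    (𝓕 : Filtration ℝ≥0 m) (P : Measure Ω) : Prop :=
  IsSemimartingale Y 𝓕 P ∧ (∀ ω, Y 0 ω = 0) ∧
    ∃ μ σsq : ℝ, 0 ≤ μ ∧ 0 < σsq ∧ γ = μ / σsq ∧
      Supermartingale (fun t ω => Y t ω + μ * (t : ℝ)) 𝓕 P ∧
      ∃ Q : ℝ≥0 → Ω → ℝ, IsQuadraticVariation Y Q P ∧
        Supermartingale (fun t ω => Q t ω - σsq * (t : ℝ)) 𝓕 P

/-- The extended real random variable `Y* = sup {Y t : t ≥ 0}`. -/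
noncomputable def pathSup {Ω : Type*} (Y : ℝ≥0 → Ω → ℝ) (ω : Ω) : EReal :=
  ⨆ t : ℝ≥0, (Y t ω : EReal)

/-! One random time `T` carries all the randomness. Before `T` the process follows a deterministic
smooth path, at `T` it makes one jump `J T`, and afterwards it drifts with slope `-μ`. Each path is
Lipschitz plus one step, so the process has locally finite variation and its quadratic variation is
the squared jump. With survival function `S` and density `g` of `T`, both supermartingale properties
reduce to inequalities between functions of `t`: `F' S + J g ≤ 0` for the drift and `J² g ≤ σ² S`
for the variance (`timedDriftDown_singleJump`).

For `γ = 0` the path grows like a logarithm, compensated by a downward jump. The jump never comes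
with probability `1/2`, and then the supremum is infinite.

For `γ > 0`, in units where `γ = 1`, write `w` for `timeScale`. The path before the jump is `-(w -
1)`, and a jump of `2 (w - 1)` reflects it to `w - 1`. If a finite jump comes after the clock `w`
with probability `p / w`, then `S → 1 - p` while `J² g → 4 p`, so the variance bound requires `p ≤
1/5`. For `p = 1/5` the mean upward rate `J g / S` is asymptotic to `1 / (2 w)`, which the term `1/2
* log (1 + t)` offsets. The supremum reaches `a` whenever a finite jump comes after the clock `1 + γ
a`, hence the tail bound. The mean is infinite because the harmonic series diverges. -/

/-- A function whose increments are dominated by those of a real function has locally bounded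
variation. -/
theorem locallyBoundedVariationOn_of_abs_sub_le {α : Type*} [LinearOrder α] {f g : α → ℝ}
    (h : ∀ s u, s ≤ u → |f u - f s| ≤ g u - g s) : LocallyBoundedVariationOn f Set.univ := by
  have hg : MonotoneOn g Set.univ := fun s _ u _ hsu => by
    linarith [abs_nonneg (f u - f s), h s u hsu]
  intro a b ha hb
  refine ne_top_of_le_ne_top (hg.locallyBoundedVariationOn a b ha hb) (iSup_mono fun p => ?_)
  refine Finset.sum_le_sum fun i _ => ?_
  rw [edist_dist, edist_dist, Real.dist_eq, Real.dist_eq]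
  exact ENNReal.ofReal_le_ofReal ((h _ _ (p.2.2.1 (Nat.le_succ i))).trans (le_abs_self _))

/-! ### Lipschitz paths with one jump -/

section StepPath

variable {C : ℝ≥0 → ℝ} {L : ℝ≥0} {T : ℝ≥0} {d : ℝ}

theorem isCadlagPath_add_step (hC : Continuous C) (T : ℝ≥0) (d : ℝ) :
    IsCadlagPath (fun t => C t + if T ≤ t then d else 0) := by
  intro t
  constructor
  · refine hC.continuousWithinAt.add ?_
    by_cases h : T ≤ t
    · refine (continuousWithinAt_const (b := d)).congr (fun x hx => ?_) ?_
      · simp [h.trans (Set.mem_Ici.1 hx)]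
      · simp [h]
    · refine ContinuousAt.continuousWithinAt ?_
      refine (continuousAt_const (y := (0 : ℝ))).congr ?_
      filter_upwards [Iio_mem_nhds (not_le.1 h)] with x hx
      simp [not_le.2 (Set.mem_Iio.1 hx)]
  · by_cases h : T < t
    · refine ⟨C t + d, ((hC.tendsto t).mono_left nhdsWithin_le_nhds).add ?_⟩
      refine tendsto_const_nhds.congr' ?_
      filter_upwards [mem_nhdsWithin_of_mem_nhds (Ioi_mem_nhds h)] with x hx
      simp [(le_of_lt hx : T ≤ x)]
    · refine ⟨C t + 0, ((hC.tendsto t).mono_left nhdsWithin_le_nhds).add ?_⟩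
      refine tendsto_const_nhds.congr' ?_
      filter_upwards [self_mem_nhdsWithin] with x hx
      simp [not_le.2 (lt_of_lt_of_le hx (not_lt.1 h))]

theorem LipschitzWith.abs_sub_le_of_le (hC : LipschitzWith L C) {s u : ℝ≥0} (hsu : s ≤ u) :
    |C u - C s| ≤ L * ((u : ℝ) - s) := by
  have := hC.dist_le_mul u s
  rwa [Real.dist_eq, NNReal.dist_eq, abs_of_nonneg (sub_nonneg.2 (NNReal.coe_le_coe.2 hsu))] at this

theorem locallyBoundedVariationOn_add_step (hC : LipschitzWith L C) (T : ℝ≥0) (d : ℝ) :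
    LocallyBoundedVariationOn (fun t => C t + if T ≤ t then d else 0) Set.univ := by
  refine locallyBoundedVariationOn_of_abs_sub_le
    (g := fun t => L * (t : ℝ) + if T ≤ t then |d| else 0) fun s u hsu => ?_
  have h := abs_le.1 (hC.abs_sub_le_of_le hsu)
  have h1 := neg_abs_le d
  have h2 := le_abs_self d
  have h3 := abs_nonneg d
  rw [abs_le]
  by_cases hs : T ≤ s
  · simp only [hs, hs.trans hsu, if_true]
    constructor <;> linarith [h.1, h.2]
  · by_cases hu : T ≤ u
    · simp only [hs, hu, if_true, if_false]
      constructor <;> linarith [h.1, h.2]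
    · simp only [hs, hu, if_false]
      constructor <;> linarith [h.1, h.2]

theorem IsPartitionSeq.le_succ {t : ℝ≥0} {k : ℕ → ℕ} {τ : ℕ → ℕ → ℝ≥0}
    (hτ : IsPartitionSeq t k τ) {n i : ℕ} (hi : i < k n) : τ n i ≤ τ n (i + 1) :=
  (hτ.lt_succ n i hi).le

/-- A Lipschitz path with one jump has the square of that jump as its quadratic variation. -/
theorem tendsto_sum_sq_add_step (hC : LipschitzWith L C) (hT : 0 < T) (d : ℝ) {t : ℝ≥0}
    {k : ℕ → ℕ} {τ : ℕ → ℕ → ℝ≥0} (hτ : IsPartitionSeq t k τ) :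
    Tendsto (fun n => ∑ i ∈ Finset.range (k n),
      ((C (τ n (i + 1)) + if T ≤ τ n (i + 1) then d else 0)
        - (C (τ n i) + if T ≤ τ n i then d else 0)) ^ 2) atTop
      (𝓝 (if T ≤ t then d ^ 2 else 0)) := by
  set I : ℝ≥0 → ℝ := fun s => if T ≤ s then 1 else 0 with hI
  have hIt : (if T ≤ t then d ^ 2 else 0) = d ^ 2 * (I t - I 0) := by
    simp only [hI, not_le.2 hT, if_false, sub_zero]
    split_ifs <;> simp
  have hId : ∀ s, (if T ≤ s then d else 0) = d * I s := fun s => by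
    simp only [hI]; split_ifs <;> simp
  rw [hIt]
  simp only [hId]
  -- Increments of `I` equal their own squares, so the squared jump `d ^ 2` is also a telescoping
  -- sum over the partition.
  have hI01 : ∀ s u, s ≤ u → (I u - I s = 0 ∨ I u - I s = 1) := by
    intro s u hsu
    simp only [hI]
    by_cases hs : T ≤ s
    · simp [hs, hs.trans hsu]
    · by_cases hu : T ≤ u <;> simp [hs, hu]
  -- The error is at most `K` times the mesh: `L ^ 2 * t` bounds the squared Lipschitz increments,
  -- and `2 * |d| * L` the cross term on the interval containing the jump.
  set K : ℝ := L ^ 2 * t + 2 * |d| * L with hK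
  have hK0 : 0 ≤ K := by positivity
  have key : ∀ ε : ℝ, 0 < ε → ∀ᶠ n in atTop, |(∑ i ∈ Finset.range (k n),
      ((C (τ n (i + 1)) + d * I (τ n (i + 1))) - (C (τ n i) + d * I (τ n i))) ^ 2)
        - d ^ 2 * (I t - I 0)| ≤ K * ε := by
    intro ε hε
    filter_upwards [hτ.mesh ε hε] with n hn
    have e1 : d ^ 2 * (I t - I 0)
        = ∑ i ∈ Finset.range (k n), d ^ 2 * (I (τ n (i + 1)) - I (τ n i)) := by
      rw [← Finset.mul_sum, Finset.sum_range_sub (fun i => I (τ n i)), hτ.last, hτ.first]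
    have e2 : K * ε ≥ ∑ i ∈ Finset.range (k n),
        (L ^ 2 * ε * ((τ n (i + 1) : ℝ) - τ n i)
          + 2 * |d| * L * ε * (I (τ n (i + 1)) - I (τ n i))) := by
      rw [Finset.sum_add_distrib, ← Finset.mul_sum, ← Finset.mul_sum,
        Finset.sum_range_sub (fun i => I (τ n i)),
        Finset.sum_range_sub (fun i => ((τ n i : ℝ≥0) : ℝ)), hτ.last, hτ.first, hK]
      have h1 : I t - I 0 ≤ 1 := by
        rcases hI01 0 t (zero_le) with h | h <;> rw [h]; norm_num
      have h2 : 0 ≤ 2 * |d| * L * ε := by positivity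
      have h3 := mul_le_mul_of_nonneg_left h1 h2
      simp only [NNReal.coe_zero, sub_zero]
      linarith
    rw [e1, ← Finset.sum_sub_distrib]
    refine ((Finset.abs_sum_le_sum_abs _ _).trans (Finset.sum_le_sum fun i hi => ?_)).trans e2
    have hi' := Finset.mem_range.1 hi
    have hle := hτ.le_succ hi'
    have hm := (hn i hi').le
    have hc := hC.abs_sub_le_of_le hle
    set a := C (τ n (i + 1)) - C (τ n i) with ha
    set x : ℝ := (τ n (i + 1) : ℝ) - τ n i with hx
    have hx0 : 0 ≤ x := by
      rw [hx, sub_nonneg]; exact_mod_cast hle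
    have hL : (0 : ℝ) ≤ L := L.2
    have ha2 : a ^ 2 ≤ L ^ 2 * ε * x := by
      rw [← sq_abs]
      calc |a| ^ 2 ≤ (L * x) ^ 2 := by gcongr
        _ = L ^ 2 * x * x := by ring
        _ ≤ L ^ 2 * ε * x := by gcongr
    have hae : |a| ≤ L * ε := hc.trans (by gcongr)
    have e3 : C (τ n (i + 1)) + d * I (τ n (i + 1)) - (C (τ n i) + d * I (τ n i))
        = a + d * (I (τ n (i + 1)) - I (τ n i)) := by rw [ha]; ring
    rw [e3]
    rcases hI01 _ _ hle with h | h <;> rw [h]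
    · simpa using ha2
    · have e4 : (a + d * 1) ^ 2 - d ^ 2 * 1 = a ^ 2 + 2 * d * a := by ring
      rw [e4]
      refine (abs_add_le _ _).trans ?_
      rw [abs_of_nonneg (sq_nonneg a), abs_mul, abs_mul, abs_two, mul_one]
      have : 2 * |d| * |a| ≤ 2 * |d| * (L * ε) := by gcongr
      linarith
  rw [Metric.tendsto_nhds]
  intro δ hδ
  filter_upwards [key (δ / (K + 1)) (by positivity)] with n hn
  rw [Real.dist_eq]
  refine hn.trans_lt ?_
  rw [mul_div_assoc', div_lt_iff₀ (by positivity)]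
  nlinarith

end StepPath

/-! ### The filtration of a random time -/

/-- The filtration of a random time, seen through the decreasing family of events `A t` that the
time has not come by `t`: an event is known at time `t` if, up to null sets, it contains `A t` or
is disjoint from it. -/
def survivalFiltration {Ω : Type*} {m : MeasurableSpace Ω} (P : Measure Ω) (A : ℝ≥0 → Set Ω)
    (hA : Antitone A) : Filtration ℝ≥0 m where
  seq t :=
    { MeasurableSet' := fun s => MeasurableSet s ∧ (P (A t ∩ s) = 0 ∨ P (A t \ s) = 0)
      measurableSet_empty := by simp
      measurableSet_compl := fun s hs => ⟨hs.1.compl, by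
        rw [← Set.sdiff_eq, Set.sdiff_compl]; exact hs.2.symm⟩
      measurableSet_iUnion := fun f hf => ⟨MeasurableSet.iUnion fun i => (hf i).1, by
        by_cases h : ∃ i, P (A t \ f i) = 0
        · obtain ⟨i, hi⟩ := h
          exact Or.inr (measure_mono_null (by gcongr; exact Set.subset_iUnion f i) hi)
        · left
          rw [Set.inter_iUnion, measure_iUnion_null_iff]
          exact fun i => (hf i).2.resolve_right fun hi => h ⟨i, hi⟩⟩ }
  mono' := fun s t hst B hB => ⟨hB.1, hB.2.imp
    (measure_mono_null (by gcongr; exact hA hst)) (measure_mono_null (by gcongr; exact hA hst))⟩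
  le' := fun t s hs => hs.1

section SurvivalFiltration

variable {Ω : Type*} {m : MeasurableSpace Ω} {P : Measure Ω} {A : ℝ≥0 → Set Ω} {hA : Antitone A}

theorem measurableSet_survivalFiltration {t : ℝ≥0} {s : Set Ω} :
    MeasurableSet[survivalFiltration P A hA t] s ↔
      MeasurableSet s ∧ (P (A t ∩ s) = 0 ∨ P (A t \ s) = 0) := Iff.rfl

/-- For right-continuity take `u n` decreasing to `t`, so that `A (u n)` increases. An event that
misses `A (u n)` for all late `n` misses their union, which covers `A t`. Otherwise it contains `A
(u n)` up to null sets for arbitrarily large `n`, hence for all `n`, and so contains `A t`. -/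
theorem usualConditions_survivalFiltration (hP : P.IsComplete)
    (hcont : ∀ t (u : ℕ → ℝ≥0), (∀ n, t < u n) → Tendsto u atTop (𝓝 t) → A t ⊆ ⋃ n, A (u n)) :
    UsualConditions (survivalFiltration P A hA) P where
  complete := hP
  rightCont := by
    refine ⟨fun t s hs => ?_⟩
    rw [Filtration.rightCont_eq] at hs
    simp only [MeasurableSpace.measurableSet_iInf] at hs
    obtain ⟨u, hu_anti, hu_gt, hu⟩ := exists_seq_strictAnti_tendsto t
    have hs' := fun n => measurableSet_survivalFiltration.1 (hs (u n) (hu_gt n))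
    refine measurableSet_survivalFiltration.2 ⟨(hs' 0).1, ?_⟩
    have hsub : ∀ N, A t ⊆ ⋃ n, A (u (n + N)) := fun N =>
      hcont t _ (fun n => hu_gt _) ((tendsto_add_atTop_iff_nat N).2 hu)
    by_cases h : ∃ N, ∀ n, P (A (u (n + N)) ∩ s) = 0
    · obtain ⟨N, hN⟩ := h
      left
      refine measure_mono_null (t := ⋃ n, A (u (n + N)) ∩ s) ?_ (measure_iUnion_null hN)
      rw [← Set.iUnion_inter]
      exact Set.inter_subset_inter_left _ (hsub N)
    · push Not at h
      right
      refine measure_mono_null (t := ⋃ n, A (u (n + 0)) \ s) ?_ (measure_iUnion_null fun N => ?_)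
      · rw [← Set.iUnion_sdiff]
        exact Set.sdiff_subset_sdiff_left (hsub 0)
      · obtain ⟨n, hn⟩ := h N
        refine measure_mono_null ?_ ((hs' (n + N)).2.resolve_left hn)
        exact Set.sdiff_subset_sdiff_left (hA (hu_anti.antitone (by omega)))
  null_mem := fun s hs => ⟨hP.out s hs, Or.inl (measure_mono_null Set.inter_subset_right hs)⟩

/-- A measurable function that is constant on `A t` is known at time `t`. -/
theorem stronglyMeasurable_survivalFiltration {X : Ω → ℝ} (hX : Measurable X) {t : ℝ≥0} {a : ℝ}
    (ha : ∀ ω ∈ A t, X ω = a) : StronglyMeasurable[survivalFiltration P A hA t] X := by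
  refine Measurable.stronglyMeasurable fun B hB => ⟨hX hB, ?_⟩
  by_cases haB : a ∈ B
  · right
    have : A t \ X ⁻¹' B = ∅ := by
      ext ω
      simp only [Set.mem_sdiff, Set.mem_preimage, Set.mem_empty_iff_false, iff_false]
      exact fun h => h.2 (by rwa [ha ω h.1])
    simp [this]
  · left
    have : A t ∩ X ⁻¹' B = ∅ := by
      ext ω
      simp only [Set.mem_inter_iff, Set.mem_preimage, Set.mem_empty_iff_false, iff_false]
      exact fun h => haB (by rw [← ha ω h.1]; exact h.2)
    simp [this]

/-- To be a supermartingale for the filtration of a random time, an adapted process only has to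
decrease pointwise after that time and on average before it. -/
theorem supermartingale_survivalFiltration [IsFiniteMeasure P] (hAm : ∀ t, MeasurableSet (A t))
    {X : ℝ≥0 → Ω → ℝ} (hadp : StronglyAdapted (survivalFiltration P A hA) X)
    (hint : ∀ t, Integrable (X t) P) (hafter : ∀ s t, s ≤ t → ∀ ω ∉ A s, X t ω ≤ X s ω)
    (hbefore : ∀ s t, s ≤ t → ∫ ω in A s, X t ω ∂P ≤ ∫ ω in A s, X s ω ∂P) :
    Supermartingale X (survivalFiltration P A hA) P := by
  rw [← neg_neg X]
  refine (submartingale_of_setIntegral_le hadp.neg (fun t => (hint t).neg) ?_).neg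
  intro s t hst B hB
  simp only [Pi.neg_apply, integral_neg, neg_le_neg_iff]
  obtain ⟨hBm, hB⟩ := measurableSet_survivalFiltration.1 hB
  -- Split `B` along `A s`. Off `A s` the comparison is pointwise; `B ∩ A s` is either null or
  -- almost all of `A s`, where only the mean matters.
  rw [← integral_inter_add_sdiff (s := B) (hAm s) (hint t).integrableOn,
    ← integral_inter_add_sdiff (s := B) (hAm s) (hint s).integrableOn]
  refine add_le_add ?_ (setIntegral_mono_on (hint t).integrableOn (hint s).integrableOn
    (hBm.diff (hAm s)) fun ω hω => hafter s t hst ω hω.2)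
  rcases hB with h | h
  · rw [Set.inter_comm, setIntegral_measure_zero _ h, setIntegral_measure_zero _ h]
  · have : (B ∩ A s : Set Ω) =ᵐ[P] A s := by
      refine Set.inter_subset_right.eventuallyLE.antisymm (ae_le_set.2 ?_)
      rwa [Set.sdiff_inter_self_eq_sdiff]
    rw [setIntegral_congr_set this, setIntegral_congr_set this]
    exact hbefore s t hst

end SurvivalFiltration

/-! ### The law of the jump time -/

/-- `S` is the survival function `t ↦ P (t < T)` of a random time `T > 0` that has density `g` on
`(0, ∞)` and is infinite with probability `c`. -/
structure IsSurvivalFunction (S g : ℝ → ℝ) (c : ℝ) : Prop where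
  hasDerivAt : ∀ t, 0 ≤ t → HasDerivAt S (-g t) t
  nonneg : ∀ t, 0 ≤ t → 0 ≤ g t
  measurable : Measurable g
  continuousOn : ContinuousOn g (Set.Ici 0)
  zero : S 0 = 1
  const_nonneg : 0 ≤ c
  tendsto : Tendsto S atTop (𝓝 c)

/-- The law on `ℝ` of a random time that has density `g` on `(0, ∞)` and is infinite with
probability `c`; the value `0` encodes the infinite time. -/
noncomputable def jumpTimeLaw (g : ℝ → ℝ) (c : ℝ) : Measure ℝ :=
  (volume.restrict (Set.Ioi 0)).withDensity (fun x => ENNReal.ofReal (g x))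
    + ENNReal.ofReal c • Measure.dirac 0

/-- The event that a time encoded as in `jumpTimeLaw` is later than `t`. -/
def notYet (t : ℝ≥0) : Set ℝ := (Set.Ioc (0 : ℝ) t)ᶜ

theorem notYet_anti : Antitone notYet := fun _ _ h =>
  Set.compl_subset_compl.2 (Set.Ioc_subset_Ioc_right (NNReal.coe_le_coe.2 h))

theorem measurableSet_notYet (t : ℝ≥0) : MeasurableSet (notYet t) := measurableSet_Ioc.compl

theorem notYet_subset_iUnion (t : ℝ≥0) (u : ℕ → ℝ≥0) (hu : Tendsto u atTop (𝓝 t)) :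
    notYet t ⊆ ⋃ n, notYet (u n) := by
  intro ω hω
  rw [Set.mem_iUnion]
  by_cases h0 : 0 < ω
  · have ht : (t : ℝ) < ω := not_le.1 fun h => hω ⟨h0, h⟩
    obtain ⟨n, hn⟩ := (((NNReal.continuous_coe.tendsto t).comp hu).eventually
      (Iio_mem_nhds ht)).exists
    exact ⟨n, fun h => (not_le.2 hn) h.2⟩
  · exact ⟨0, fun h => h0 h.1⟩

section Law

variable {S g : ℝ → ℝ} {c : ℝ}

theorem jumpTimeLaw_restrict {s : Set ℝ} (hs : MeasurableSet s)
    (hs0 : s ⊆ Set.Ioi 0) : (jumpTimeLaw g c).restrict s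
      = (volume.restrict s).withDensity (fun x => ENNReal.ofReal (g x)) := by
  have h0 : (0 : ℝ) ∉ s := fun h => lt_irrefl _ (Set.mem_Ioi.1 (hs0 h))
  rw [jumpTimeLaw, Measure.restrict_add, restrict_withDensity hs, Measure.restrict_restrict hs,
    Set.inter_eq_left.2 hs0, Measure.restrict_smul,
    Measure.restrict_eq_zero (μ := Measure.dirac (0 : ℝ)).2
      (by rw [Measure.dirac_apply' _ hs]; simp [h0]), smul_zero, add_zero]

theorem setIntegral_Ioc_jumpTimeLaw (h : IsSurvivalFunction S g c) (φ : ℝ → ℝ) {s t : ℝ}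
    (hs : 0 ≤ s) (hst : s ≤ t) :
    ∫ x in Set.Ioc s t, φ x ∂(jumpTimeLaw g c) = ∫ x in s..t, g x * φ x := by
  rw [jumpTimeLaw_restrict measurableSet_Ioc
      (fun x hx => lt_of_le_of_lt hs hx.1), intervalIntegral.integral_of_le hst,
    integral_withDensity_eq_integral_toReal_smul h.measurable.ennreal_ofReal
      (ae_of_all _ fun _ => ENNReal.ofReal_lt_top)]
  refine setIntegral_congr_fun measurableSet_Ioc fun x hx => ?_
  rw [ENNReal.toReal_ofReal (h.nonneg x (hs.trans hx.1.le)), smul_eq_mul]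

theorem jumpTimeLaw_Ioi (h : IsSurvivalFunction S g c) {t : ℝ} (ht : 0 ≤ t) :
    jumpTimeLaw g c (Set.Ioi t) = ENNReal.ofReal (S t - c) := by
  have hd : ∀ x ∈ Set.Ici t, HasDerivAt (fun x => - S x) (g x) x := fun x hx => by
    simpa using (h.hasDerivAt x (ht.trans hx)).fun_neg
  have hp : ∀ x ∈ Set.Ioi t, 0 ≤ g x := fun x hx => h.nonneg x (ht.trans (le_of_lt hx))
  have hint := integrableOn_Ioi_deriv_of_nonneg' hd hp h.tendsto.neg
  have hval := integral_Ioi_of_hasDerivAt_of_nonneg' hd hp h.tendsto.neg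
  rw [← Measure.restrict_apply_self, jumpTimeLaw_restrict measurableSet_Ioi
      (Set.Ioi_subset_Ioi ht), withDensity_apply _ measurableSet_Ioi,
    Measure.restrict_restrict measurableSet_Ioi, Set.inter_self,
    ← ofReal_integral_eq_lintegral_ofReal hint
      ((ae_restrict_iff' measurableSet_Ioi).2 (ae_of_all _ hp)), hval]
  congr 1; ring

theorem jumpTimeLaw_Iic (g : ℝ → ℝ) (c : ℝ) :
    jumpTimeLaw g c (Set.Iic 0) = ENNReal.ofReal c := by
  rw [jumpTimeLaw, Measure.add_apply, withDensity_apply _ measurableSet_Iic,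
    Measure.restrict_restrict measurableSet_Iic, Set.Iic_inter_Ioi]
  simp

theorem jumpTimeLaw_singleton_zero (g : ℝ → ℝ) (c : ℝ) :
    jumpTimeLaw g c {0} = ENNReal.ofReal c := by
  rw [jumpTimeLaw, Measure.add_apply, withDensity_apply _ (measurableSet_singleton 0),
    Measure.restrict_restrict (measurableSet_singleton 0)]
  simp

theorem IsSurvivalFunction.antitoneOn (h : IsSurvivalFunction S g c) :
    AntitoneOn S (Set.Ici 0) :=
  antitoneOn_of_deriv_nonpos (convex_Ici 0)
    (fun x hx => (h.hasDerivAt x hx).continuousAt.continuousWithinAt)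
    (fun x hx => (h.hasDerivAt x (interior_subset hx)).differentiableAt.differentiableWithinAt)
    (fun x hx => by
      rw [(h.hasDerivAt x (interior_subset hx)).deriv, neg_nonpos]
      exact h.nonneg x (interior_subset hx))

theorem IsSurvivalFunction.const_le (h : IsSurvivalFunction S g c) {t : ℝ} (ht : 0 ≤ t) :
    c ≤ S t :=
  le_of_tendsto h.tendsto (by
    filter_upwards [eventually_ge_atTop t] with u hu
    exact h.antitoneOn ht (ht.trans hu) hu)

/-- The half-line up to `0` carries only the atom of mass `c`, and the times after `t` have mass `S
t - c`. -/
theorem jumpTimeLaw_notYet (h : IsSurvivalFunction S g c) (t : ℝ≥0) :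
    jumpTimeLaw g c (notYet t) = ENNReal.ofReal (S t) := by
  have e : notYet t = Set.Iic 0 ∪ Set.Ioi (t : ℝ) := by
    ext x; simp only [notYet, Set.mem_compl_iff, Set.mem_Ioc, Set.mem_union, Set.mem_Iic,
      Set.mem_Ioi, not_and_or, not_lt, not_le]
  have hd : Disjoint (Set.Iic (0 : ℝ)) (Set.Ioi (t : ℝ)) :=
    Set.disjoint_left.2 fun x hx hx' => absurd (lt_of_le_of_lt t.2 hx') (not_lt.2 hx)
  rw [e, measure_union hd measurableSet_Ioi, jumpTimeLaw_Iic, jumpTimeLaw_Ioi h t.coe_nonneg,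
    ← ENNReal.ofReal_add h.const_nonneg (sub_nonneg.2 (h.const_le t.coe_nonneg))]
  congr 1; ring

theorem isProbabilityMeasure_jumpTimeLaw (h : IsSurvivalFunction S g c) :
    IsProbabilityMeasure (jumpTimeLaw g c) := by
  have := jumpTimeLaw_notYet h 0
  have e : notYet 0 = Set.univ := by simp [notYet]
  rw [e, NNReal.coe_zero, h.zero, ENNReal.ofReal_one] at this
  exact ⟨this⟩

end Law

section Completion

variable {α : Type*} [MeasurableSpace α] {ν : Measure α}

theorem Measurable.completion {β : Type*} [MeasurableSpace β] {f : α → β} (hf : Measurable f) :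
    @Measurable (NullMeasurableSpace α ν) β _ _ f := fun _ hs => (hf hs).nullMeasurableSet

/-- The identity from the completed space to the original one preserves the measure. -/
theorem setIntegral_completion {f : α → ℝ} (hf : Measurable f) {s : Set α}
    (hs : MeasurableSet s) :
    ∫ x in (s : Set (NullMeasurableSpace α ν)), f x ∂ν.completion = ∫ x in s, f x ∂ν := by
  have hid : @Measurable (NullMeasurableSpace α ν) α _ _ (fun x => x) :=
    measurable_id.completion
  have hmap : @Measure.map (NullMeasurableSpace α ν) α _ _ (fun x => x) ν.completion = ν := by
    ext t ht
    rw [Measure.map_apply hid ht]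
    rfl
  have := setIntegral_map (X := NullMeasurableSpace α ν) (Y := α) (μ := ν.completion)
    (g := fun x => x) hs (f := f) hf.aestronglyMeasurable hid.aemeasurable
  rw [hmap] at this
  exact this.symm

end Completion

/-! ### Processes frozen at the random time -/

/-- The process that follows `a` until a random time `T = ω` and is frozen at `φ T` from `T` on. -/
noncomputable def frozenPath (a φ : ℝ → ℝ) (t : ℝ≥0) (ω : ℝ) : ℝ :=
  open Classical in if ω ∈ Set.Ioc (0 : ℝ) t then φ ω else a t

section Frozen

variable {a φ : ℝ → ℝ}

theorem frozenPath_of_mem_notYet {t : ℝ≥0} {ω : ℝ} (h : ω ∈ notYet t) :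
    frozenPath a φ t ω = a t := if_neg h

theorem frozenPath_of_mem {t : ℝ≥0} {ω : ℝ} (h : ω ∈ Set.Ioc (0 : ℝ) t) :
    frozenPath a φ t ω = φ ω := if_pos h

theorem frozenPath_eq_of_notMem_notYet {s t : ℝ≥0} (hst : s ≤ t) {ω : ℝ} (h : ω ∉ notYet s) :
    frozenPath a φ t ω = frozenPath a φ s ω := by
  have h' : ω ∈ Set.Ioc (0 : ℝ) s := not_not.1 h
  rw [frozenPath_of_mem h', frozenPath_of_mem
    (Set.Ioc_subset_Ioc_right (NNReal.coe_le_coe.2 hst) h')]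

theorem measurable_frozenPath (hφ : Measurable φ) (t : ℝ≥0) :
    Measurable (frozenPath a φ t) :=
  Measurable.ite measurableSet_Ioc hφ measurable_const

theorem exists_abs_frozenPath_le (hφ : ContinuousOn φ (Set.Ici 0)) (t : ℝ≥0) :
    ∃ K, ∀ ω, |frozenPath a φ t ω| ≤ K := by
  obtain ⟨K, hK⟩ := (isCompact_Icc (a := (0 : ℝ)) (b := t)).exists_bound_of_continuousOn
    (hφ.mono fun x hx => hx.1)
  refine ⟨max K |a t|, fun ω => ?_⟩
  by_cases h : ω ∈ Set.Ioc (0 : ℝ) t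
  · rw [frozenPath_of_mem h]
    exact (hK ω ⟨h.1.le, h.2⟩).trans (le_max_left _ _)
  · rw [frozenPath_of_mem_notYet h]
    exact le_max_right _ _

variable {S g : ℝ → ℝ} {c : ℝ}

/-- If the time has not come by `s`, either it has not come by `t`, where the process equals `a t`,
or it falls in `(s, t]` and the value is `φ` there. -/
theorem setIntegral_notYet_frozenPath (h : IsSurvivalFunction S g c) (hφm : Measurable φ)
    (hφ : ContinuousOn φ (Set.Ici 0)) {s t : ℝ≥0} (hst : s ≤ t) :
    ∫ ω in notYet s, frozenPath a φ t ω ∂(jumpTimeLaw g c)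
      = a t * S t + ∫ x in (s : ℝ)..t, g x * φ x := by
  have := isProbabilityMeasure_jumpTimeLaw h
  have hint : Integrable (frozenPath a φ t) (jumpTimeLaw g c) := by
    obtain ⟨K, hK⟩ := exists_abs_frozenPath_le (a := a) hφ t
    exact Integrable.of_bound (measurable_frozenPath hφm t).aestronglyMeasurable K
      (ae_of_all _ hK)
  have hst' : (s : ℝ) ≤ t := NNReal.coe_le_coe.2 hst
  have e : notYet s = notYet t ∪ Set.Ioc (s : ℝ) t := by
    ext x
    have := s.coe_nonneg
    simp only [notYet, Set.mem_compl_iff, Set.mem_Ioc, Set.mem_union]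
    grind
  have hd : Disjoint (notYet t) (Set.Ioc (s : ℝ) t) :=
    Set.disjoint_left.2 fun x hx hx' => hx ⟨lt_of_le_of_lt s.coe_nonneg hx'.1, hx'.2⟩
  rw [e, setIntegral_union hd measurableSet_Ioc hint.integrableOn hint.integrableOn,
    setIntegral_congr_fun (measurableSet_notYet t)
      (fun ω hω => frozenPath_of_mem_notYet (a := a) (φ := φ) hω),
    setIntegral_congr_fun (g := φ) measurableSet_Ioc
      (fun ω hω => frozenPath_of_mem ⟨lt_of_le_of_lt s.coe_nonneg hω.1, hω.2⟩),
    setIntegral_Ioc_jumpTimeLaw h φ s.coe_nonneg hst', setIntegral_const, measureReal_def,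
    jumpTimeLaw_notYet h, ENNReal.toReal_ofReal
      (h.const_nonneg.trans (h.const_le t.coe_nonneg)), smul_eq_mul, mul_comm]

/-- The filtration generated by the random time, on the completed probability space. -/
noncomputable def jumpFiltration (g : ℝ → ℝ) (c : ℝ) :
    Filtration ℝ≥0 (NullMeasurableSpace.instMeasurableSpace (α := ℝ) (μ := jumpTimeLaw g c)) :=
  survivalFiltration (jumpTimeLaw g c).completion notYet notYet_anti

theorem usualConditions_jumpFiltration (g : ℝ → ℝ) (c : ℝ) :
    UsualConditions (jumpFiltration g c) (jumpTimeLaw g c).completion :=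
  usualConditions_survivalFiltration (Measure.completion.isComplete _)
    fun t u _ hu => notYet_subset_iUnion t u hu

theorem isProbabilityMeasure_completion (h : IsSurvivalFunction S g c) :
    IsProbabilityMeasure (jumpTimeLaw g c).completion :=
  ⟨(isProbabilityMeasure_jumpTimeLaw h).measure_univ⟩

theorem stronglyAdapted_frozenPath_add (hφm : Measurable φ) (b : ℝ≥0 → ℝ) :
    StronglyAdapted (jumpFiltration g c) fun t ω => frozenPath a φ t ω + b t := fun t =>
  stronglyMeasurable_survivalFiltration (a := a t + b t)
    ((measurable_frozenPath hφm t).add_const _).completion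
    fun ω hω => by simp only [frozenPath_of_mem_notYet hω]

/-- A frozen process plus a nonincreasing deterministic function is a supermartingale if its mean
on the event that the random time has not come yet is nonincreasing. -/
theorem supermartingale_frozenPath_add (h : IsSurvivalFunction S g c) (hφm : Measurable φ)
    (hφ : ContinuousOn φ (Set.Ici 0)) {b : ℝ≥0 → ℝ} (hb : Antitone b)
    (hle : ∀ s t : ℝ≥0, s ≤ t →
      a t * S t + (∫ x in (s : ℝ)..t, g x * φ x) + b t * S s ≤ a s * S s + b s * S s) :
    Supermartingale (fun t ω => frozenPath a φ t ω + b t) (jumpFiltration g c)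
      (jumpTimeLaw g c).completion := by
  have := isProbabilityMeasure_jumpTimeLaw h
  have := isProbabilityMeasure_completion h
  have hS : ∀ s : ℝ≥0, (jumpTimeLaw g c).real (notYet s) = S s := fun s => by
    rw [measureReal_def, jumpTimeLaw_notYet h, ENNReal.toReal_ofReal
      (h.const_nonneg.trans (h.const_le s.coe_nonneg))]
  have hint : ∀ t, Integrable (frozenPath a φ t) (jumpTimeLaw g c) := fun t => by
    obtain ⟨K, hK⟩ := exists_abs_frozenPath_le (a := a) hφ t
    exact Integrable.of_bound (measurable_frozenPath hφm t).aestronglyMeasurable K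
      (ae_of_all _ hK)
  have hset : ∀ s t : ℝ≥0, s ≤ t →
      ∫ ω in notYet s, (frozenPath a φ t ω + b t) ∂(jumpTimeLaw g c)
        = a t * S t + (∫ x in (s : ℝ)..t, g x * φ x) + b t * S s := fun s t hst => by
    rw [integral_add (hint t).integrableOn (integrable_const _),
      setIntegral_notYet_frozenPath h hφm hφ hst, setIntegral_const, hS, smul_eq_mul,
      mul_comm (b t)]
  refine supermartingale_survivalFiltration (fun t => (measurableSet_notYet t).nullMeasurableSet)
    (stronglyAdapted_frozenPath_add hφm b) (fun t => ?_) (fun s t hst ω hω => ?_)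
    (fun s t hst => ?_)
  · obtain ⟨K, hK⟩ := exists_abs_frozenPath_le (a := a) hφ t
    exact (Integrable.of_bound
      (measurable_frozenPath hφm t).completion.aestronglyMeasurable K
      (ae_of_all _ hK)).add (integrable_const _)
  · rw [frozenPath_eq_of_notMem_notYet hst hω]
    exact add_le_add_right (hb hst) _
  · have hm : ∀ t, Measurable fun ω => frozenPath a φ t ω + b t := fun t =>
      (measurable_frozenPath hφm t).add_const _
    rw [setIntegral_completion (hm t) (measurableSet_notYet s),
      setIntegral_completion (hm s) (measurableSet_notYet s), hset s t hst, hset s s le_rfl]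
    simpa using hle s t hst

end Frozen

/-! ### The single-jump process -/

/-- The process that drifts like `F t - μ t` until a random time `T = ω`, jumps by `J T` at `T`,
and drifts with slope `-μ` afterwards. -/
noncomputable def singleJump (F J : ℝ → ℝ) (μ : ℝ) (t : ℝ≥0) (ω : ℝ) : ℝ :=
  frozenPath F (fun x => F x + J x) t ω + -(μ * t)

section Jump

variable {S g F F' J : ℝ → ℝ} {c μ σsq γ : ℝ} {L : ℝ≥0}

theorem singleJump_of_mem_notYet {t : ℝ≥0} {ω : ℝ} (h : ω ∈ notYet t) :
    singleJump F J μ t ω = F t - μ * t := by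
  rw [singleJump, frozenPath_of_mem_notYet h, sub_eq_add_neg]

theorem singleJump_of_mem {t : ℝ≥0} {ω : ℝ} (h : ω ∈ Set.Ioc (0 : ℝ) t) :
    singleJump F J μ t ω = F ω + J ω - μ * t := by
  rw [singleJump, frozenPath_of_mem h, sub_eq_add_neg]

theorem singleJump_zero (hF0 : F 0 = 0) (J : ℝ → ℝ) (μ ω : ℝ) : singleJump F J μ 0 ω = 0 := by
  rw [singleJump_of_mem_notYet (by simp [notYet])]
  simp [hF0]

/-- The paths of `singleJump` are Lipschitz up to one jump. -/
theorem exists_singleJump_eq_add_step (hF : LipschitzOnWith L F (Set.Ici 0)) (J : ℝ → ℝ) (μ : ℝ)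
    (ω : ℝ) : ∃ (C : ℝ≥0 → ℝ) (K T : ℝ≥0) (d : ℝ), LipschitzWith K C ∧ 0 < T ∧
      (∀ t, singleJump F J μ t ω = C t + if T ≤ t then d else 0) ∧
      (∀ t, frozenPath (fun _ => 0) (fun x => J x ^ 2) t ω = if T ≤ t then d ^ 2 else 0) := by
  have hμ : LipschitzWith (Real.nnabs μ) (fun t : ℝ≥0 => -(μ * (t : ℝ))) := by
    refine LipschitzWith.of_dist_le_mul fun x y => ?_
    rw [Real.dist_eq, NNReal.dist_eq, neg_sub_neg, ← mul_sub, abs_mul, abs_sub_comm]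
    rfl
  by_cases h0 : 0 < ω
  · lift ω to ℝ≥0 using h0.le
    have hmem : ∀ t : ℝ≥0, (ω : ℝ) ∈ Set.Ioc (0 : ℝ) t ↔ ω ≤ t := fun t => by
      rw [Set.mem_Ioc, and_iff_right h0, NNReal.coe_le_coe]
    refine ⟨fun t => F ((min t ω : ℝ≥0) : ℝ) + -(μ * t), L + Real.nnabs μ, ω, J ω,
      LipschitzWith.add (LipschitzWith.of_dist_le_mul fun x y => ?_) hμ, h0, fun t => ?_,
      fun t => ?_⟩
    · refine (hF.dist_le_mul _ (NNReal.coe_nonneg _) _ (NNReal.coe_nonneg _)).trans ?_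
      refine mul_le_mul_of_nonneg_left ?_ L.2
      rw [NNReal.dist_eq, Real.dist_eq, NNReal.coe_min, NNReal.coe_min]
      simpa using abs_min_sub_min_le_max (x : ℝ) ω y ω
    · simp only [singleJump, frozenPath, hmem]
      by_cases h : ω ≤ t
      · simp only [h, if_true, min_eq_right]; ring
      · simp only [h, if_false, min_eq_left (not_le.1 h).le, add_zero]
    · simp only [frozenPath, hmem]
  · have hmem : ∀ t : ℝ≥0, ¬ ω ∈ Set.Ioc (0 : ℝ) t := fun t h => h0 h.1
    -- The path has no jump; a fictitious one of size `0` at time `1` gives it the common form.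
    refine ⟨fun t => F t + -(μ * t), L + Real.nnabs μ, 1, 0,
      LipschitzWith.add (LipschitzWith.of_dist_le_mul fun x y => ?_) hμ, one_pos, fun t => ?_,
      fun t => ?_⟩
    · exact hF.dist_le_mul _ x.coe_nonneg _ y.coe_nonneg
    · simp [singleJump, frozenPath, hmem]
    · simp [frozenPath, hmem]

theorem isSemimartingale_of_isCadlagFiniteVariation {Ω : Type*} {m : MeasurableSpace Ω}
    {Y : ℝ≥0 → Ω → ℝ} {𝓕 : Filtration ℝ≥0 m} {P : Measure Ω}
    (hY : IsCadlagFiniteVariation Y 𝓕) : IsSemimartingale Y 𝓕 P := by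
  refine ⟨0, Y, ⟨fun ω t => ⟨continuousWithinAt_const, 0, tendsto_const_nhds⟩,
    (martingale_zero ℝ 𝓕 P).1, Locally.of_prop (martingale_zero ℝ 𝓕 P)⟩, hY, fun t ω => by simp⟩

theorem measurable_singleJump (hFm : Measurable F) (hJm : Measurable J) (μ : ℝ) (t : ℝ≥0) :
    Measurable (singleJump F J μ t) :=
  (measurable_frozenPath (hFm.add hJm) t).add_const _

theorem isSemimartingale_singleJump (hFm : Measurable F) (hF : LipschitzOnWith L F (Set.Ici 0))
    (hJm : Measurable J) (μ : ℝ) : IsSemimartingale (singleJump F J μ) (jumpFiltration g c)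
      (jumpTimeLaw g c).completion := by
  refine isSemimartingale_of_isCadlagFiniteVariation
    ⟨fun ω => ?_, stronglyAdapted_frozenPath_add (hFm.add hJm) _, fun ω => ?_⟩
  · obtain ⟨C, K, T, d, hC, -, hY, -⟩ := exists_singleJump_eq_add_step hF J μ ω
    rw [funext hY]
    exact isCadlagPath_add_step hC.continuous T d
  · obtain ⟨C, K, T, d, hC, -, hY, -⟩ := exists_singleJump_eq_add_step hF J μ ω
    rw [funext hY]
    exact locallyBoundedVariationOn_add_step hC T d

/-- The sums of squares converge along every path, hence in probability. -/
theorem isQuadraticVariation_singleJump (h : IsSurvivalFunction S g c) (hFm : Measurable F)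
    (hF : LipschitzOnWith L F (Set.Ici 0)) (hJm : Measurable J) (μ : ℝ) :
    IsQuadraticVariation (Ω := NullMeasurableSpace ℝ (jumpTimeLaw g c)) (singleJump F J μ)
      (frozenPath (fun _ => 0) (fun x => J x ^ 2)) (jumpTimeLaw g c).completion where
  mono ω := by
    obtain ⟨C, K, T, d, hC, -, -, hQ⟩ := exists_singleJump_eq_add_step hF J μ ω
    rw [funext hQ]
    intro s t hst
    dsimp only
    split_ifs with h1 h2
    · exact le_rfl
    · exact absurd (h1.trans hst) h2
    · positivity
    · exact le_rfl
  cadlag ω := by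
    obtain ⟨C, K, T, d, hC, -, -, hQ⟩ := exists_singleJump_eq_add_step hF J μ ω
    rw [funext hQ]
    simpa using isCadlagPath_add_step (C := fun _ => 0) continuous_const T (d ^ 2)
  tendsto t k τ hτ := by
    have := isProbabilityMeasure_completion h
    refine tendstoInMeasure_of_tendsto_ae (fun n => ?_) (ae_of_all _ fun ω => ?_)
    · refine (Measurable.completion ?_).aestronglyMeasurable
      exact Finset.measurable_sum _ fun i _ => ((measurable_singleJump hFm hJm μ _).sub
        (measurable_singleJump hFm hJm μ _)).pow_const 2
    · obtain ⟨C, K, T, d, hC, hT, hY, hQ⟩ := exists_singleJump_eq_add_step hF J μ ω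
      simp only [hY, hQ]
      exact tendsto_sum_sq_add_step hC hT d hτ

/-- If the mean rate of change of `singleJump F J μ` before its jump is at most `-μ` and the mean
rate of change of its squared jump is at most `σsq`, it is a timed drift down. -/
theorem timedDriftDown_singleJump (h : IsSurvivalFunction S g c) (hFm : Measurable F)
    (hF : LipschitzOnWith L F (Set.Ici 0)) (hF0 : F 0 = 0)
    (hF' : ∀ t, 0 ≤ t → HasDerivAt F (F' t) t) (hJm : Measurable J)
    (hJ : ContinuousOn J (Set.Ici 0)) (hμ : 0 ≤ μ) (hσ : 0 < σsq) (hγ : γ = μ / σsq)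
    (hdrift : ∀ t, 0 ≤ t → F' t * S t + J t * g t ≤ 0)
    (hvar : ∀ t, 0 ≤ t → J t ^ 2 * g t ≤ σsq * S t) :
    TimedDriftDown (Ω := NullMeasurableSpace ℝ (jumpTimeLaw g c)) (singleJump F J μ) γ
      (jumpFiltration g c) (jumpTimeLaw g c).completion := by
  refine ⟨isSemimartingale_singleJump hFm hF hJm μ, singleJump_zero hF0 J μ, μ, σsq, hμ, hσ,
    hγ, ?_, frozenPath (fun _ => 0) (fun x => J x ^ 2),
    isQuadraticVariation_singleJump h hFm hF hJm μ, ?_⟩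
  · have e : (fun (t : ℝ≥0) (ω : NullMeasurableSpace ℝ (jumpTimeLaw g c)) =>
        singleJump F J μ t ω + μ * (t : ℝ))
        = fun t ω => frozenPath F (fun x => F x + J x) t ω + (fun _ => 0) t := by
      funext t ω; simp [singleJump]
    have hφ : ContinuousOn (fun x => F x + J x) (Set.Ici 0) := hF.continuousOn.add hJ
    rw [e]
    refine supermartingale_frozenPath_add h (hFm.add hJm) hφ antitone_const fun s t hst => ?_
    have hsub : Set.Icc (s : ℝ) t ⊆ Set.Ici 0 := fun x hx => s.coe_nonneg.trans hx.1
    -- Since `S' = -g`, the derivative of `-(F S)` is `-F' S + F g`; it dominates `g (F + J)`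
    -- exactly when `F' S + J g ≤ 0`.
    have hd : ∀ x, 0 ≤ x → HasDerivAt (fun x => -(F x * S x)) (-(F' x * S x + F x * -g x)) x :=
      fun x hx => ((hF' x hx).mul (h.hasDerivAt x hx)).fun_neg
    have := intervalIntegral.integral_le_sub_of_hasDeriv_right_of_le (NNReal.coe_le_coe.2 hst)
      (fun x hx => (hd x (hsub hx)).continuousAt.continuousWithinAt)
      (fun x hx => (hd x (hsub (Set.Ioo_subset_Icc_self hx))).hasDerivWithinAt)
      (φ := fun x => g x * (F x + J x))
      (((h.continuousOn.mul hφ).mono hsub).integrableOn_Icc)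
      (fun x hx => by linarith [hdrift x (hsub (Set.Ioo_subset_Icc_self hx))])
    simp only [Pi.add_apply]
    linarith
  · have hφ : ContinuousOn (fun x => J x ^ 2) (Set.Ici 0) := hJ.pow 2
    refine supermartingale_frozenPath_add (a := fun _ => 0) (b := fun t => -(σsq * t)) h
      (hJm.pow_const 2) hφ (fun s t hst => ?_) fun s t hst => ?_
    · exact neg_le_neg (mul_le_mul_of_nonneg_left (NNReal.coe_le_coe.2 hst) hσ.le)
    · have hsub : Set.Icc (s : ℝ) t ⊆ Set.Ici 0 := fun x hx => s.coe_nonneg.trans hx.1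
      have hd : ∀ x, HasDerivAt (fun x => σsq * S s * x) (σsq * S s) x :=
        fun x => by simpa using (hasDerivAt_id x).const_mul (σsq * S s)
      have := intervalIntegral.integral_le_sub_of_hasDeriv_right_of_le (NNReal.coe_le_coe.2 hst)
        (fun x hx => (hd x).continuousAt.continuousWithinAt)
        (fun x hx => (hd x).hasDerivWithinAt) (φ := fun x => g x * J x ^ 2)
        (((h.continuousOn.mul hφ).mono hsub).integrableOn_Icc)
        -- The rate `g J²` is at most `σsq * S x`, and `S x ≤ S s` because `S` decreases.
        (fun x hx => by
          have hx' := Set.Ioo_subset_Icc_self hx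
          have := h.antitoneOn s.coe_nonneg (hsub hx') hx'.1
          nlinarith [hvar x (hsub hx')])
      linarith

end Jump

/-! ### From the tail to an infinite mean -/

section PathSup

variable {Ω : Type*} {m : MeasurableSpace Ω} {P : Measure Ω}

theorem card_le_of_forall_add_one_le {s : Finset ℕ} {x : ℝ≥0∞}
    (h : ∀ k ∈ s, ((k + 1 : ℕ) : ℝ≥0∞) ≤ x) : (s.card : ℝ≥0∞) ≤ x := by
  rcases s.eq_empty_or_nonempty with rfl | hs
  · simp
  · refine le_trans ?_ (h _ (s.max'_mem hs))
    have : s ⊆ Finset.range (s.max' hs + 1) := fun k hk =>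
      Finset.mem_range.2 (Nat.lt_succ_of_le (s.le_max' k hk))
    have := Finset.card_le_card this
    rw [Finset.card_range] at this
    exact_mod_cast this

/-- At each point, the number of events `E k` that occur is at most `X`; integrate this count. -/
theorem sum_measure_le_lintegral {X : Ω → ℝ≥0∞} {E : ℕ → Set Ω} (hE : ∀ k, MeasurableSet (E k))
    (hX : ∀ k, ∀ ω ∈ E k, ((k + 1 : ℕ) : ℝ≥0∞) ≤ X ω) (n : ℕ) :
    ∑ k ∈ Finset.range n, P (E k) ≤ ∫⁻ ω, X ω ∂P := by
  classical
  calc ∑ k ∈ Finset.range n, P (E k)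
      = ∑ k ∈ Finset.range n, ∫⁻ ω, (E k).indicator 1 ω ∂P := by
        simp [lintegral_indicator_one (hE _)]
    _ = ∫⁻ ω, ∑ k ∈ Finset.range n, (E k).indicator 1 ω ∂P :=
        (lintegral_finsetSum _ fun k _ => measurable_one.indicator (hE k)).symm
    _ ≤ ∫⁻ ω, X ω ∂P := by
        refine lintegral_mono fun ω => ?_
        have := card_le_of_forall_add_one_le (s := (Finset.range n).filter (ω ∈ E ·)) (x := X ω)
          fun k hk => hX k ω (Finset.mem_filter.1 hk).2
        simpa [Set.indicator_apply, Finset.sum_ite] using this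

/-- A process whose supremum has a tail of order at least `1 / a` has a supremum of infinite
mean. -/
theorem lintegral_pathSup_eq_top [IsFiniteMeasure P] {Y : ℝ≥0 → Ω → ℝ} {γ : ℝ} (hγ : 0 ≤ γ)
    (h : ∀ a : ℝ, 0 ≤ a → ∃ E, MeasurableSet E ∧ (∀ ω ∈ E, (a : EReal) ≤ pathSup Y ω) ∧
      1 / (5 * (1 + γ * a)) ≤ P.real E) :
    ∫⁻ ω, (pathSup Y ω).toENNReal ∂P = ⊤ := by
  choose E hEm hEsup hEP using fun k : ℕ => h (k + 1) (by positivity)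
  have hsum := sum_measure_le_lintegral (P := P) (X := fun ω => (pathSup Y ω).toENNReal) hEm
    fun k ω hω => by
      have := EReal.toENNReal_le_toENNReal (hEsup k ω hω)
      rw [EReal.toENNReal_of_ne_top (EReal.coe_ne_top _), EReal.toReal_coe] at this
      refine le_trans (le_of_eq ?_) this
      rw [← ENNReal.ofReal_natCast]
      push_cast
      rfl
  have hlow : ∀ n, ENNReal.ofReal (1 / (5 * (1 + γ)) *
      ∑ k ∈ Finset.range n, 1 / ((k : ℝ) + 1)) ≤ ∫⁻ ω, (pathSup Y ω).toENNReal ∂P := by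
    intro n
    refine le_trans ?_ (hsum n)
    rw [Finset.mul_sum, ENNReal.ofReal_sum_of_nonneg (fun k _ => by positivity)]
    refine Finset.sum_le_sum fun k _ => ?_
    rw [← ofReal_measureReal]
    refine ENNReal.ofReal_le_ofReal (le_trans ?_ (hEP k))
    rw [one_div_mul_one_div]
    -- Here `1 + γ (k + 1) ≤ (1 + γ) (k + 1)`, which leaves a multiple of the harmonic series.
    exact one_div_le_one_div_of_le (by positivity)
      (by nlinarith [mul_nonneg hγ (Nat.cast_nonneg (α := ℝ) k), Nat.cast_nonneg (α := ℝ) k])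
  have htop : Tendsto (fun n => ENNReal.ofReal (1 / (5 * (1 + γ)) *
      ∑ k ∈ Finset.range n, 1 / ((k : ℝ) + 1))) atTop (𝓝 ⊤) :=
    ENNReal.tendsto_ofReal_atTop.comp
      (Real.tendsto_sum_range_one_div_nat_succ_atTop.const_mul_atTop (by positivity))
  exact top_le_iff.1 (le_of_tendsto' htop hlow)

end PathSup

theorem coe_le_pathSup {Ω : Type*} {Y : ℝ≥0 → Ω → ℝ} {a : ℝ} {ω : Ω} (t : ℝ≥0)
    (h : a ≤ Y t ω) : (a : EReal) ≤ pathSup Y ω :=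
  (EReal.coe_le_coe_iff.2 h).trans (le_iSup (fun t => (Y t ω : EReal)) t)

/-- A measurable event on which the level is reached spares the measurability of a supremum over
uncountably many times. -/
theorem exists_measurableSet_le_pathSup {ν : Measure ℝ} {E : Set ℝ} (hE : MeasurableSet E)
    {Y : ℝ≥0 → ℝ → ℝ} {a p : ℝ} (hY : ∀ x ∈ E, ∃ t, a ≤ Y t x) (hp : p ≤ ν.real E) :
    ∃ E : Set (NullMeasurableSpace ℝ ν), MeasurableSet E ∧
      (∀ ω ∈ E, (a : EReal) ≤ pathSup (Ω := NullMeasurableSpace ℝ ν) Y ω) ∧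
      p ≤ ν.completion.real E :=
  ⟨E, hE.nullMeasurableSet, fun ω hω => (hY ω hω).elim fun t ht => coe_le_pathSup t ht, hp⟩

theorem hasDerivAt_log_one_add {t : ℝ} (ht : 0 ≤ t) :
    HasDerivAt (fun t => Real.log (1 + t)) (1 / (1 + t)) t :=
  ((hasDerivAt_id' t).const_add 1).log (by positivity)

theorem lipschitzOnWith_log_one_add :
    LipschitzOnWith 1 (fun t => Real.log (1 + t)) (Set.Ici 0) := by
  refine (convex_Ici (0 : ℝ)).lipschitzOnWith_of_nnnorm_hasDerivWithin_le
    (fun t ht => (hasDerivAt_log_one_add ht).hasDerivWithinAt) fun t ht => ?_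
  have ht : (0 : ℝ) ≤ t := ht
  rw [← NNReal.coe_le_coe, coe_nnnorm, Real.norm_of_nonneg (by positivity), NNReal.coe_one]
  exact div_le_one_of_le₀ (by linarith) (by positivity)

theorem lipschitzOnWith_const_mul_log_one_add (b : ℝ) :
    LipschitzOnWith (‖b‖₊ * 1) (fun t => b * Real.log (1 + t)) (Set.Ici 0) :=
  (lipschitzWith_smul b).comp_lipschitzOnWith lipschitzOnWith_log_one_add

theorem hasDerivAt_const_mul_log_one_add (b : ℝ) {t : ℝ} (ht : 0 ≤ t) :
    HasDerivAt (fun t => b * Real.log (1 + t)) (b * (1 / (1 + t))) t :=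
  (hasDerivAt_log_one_add ht).const_mul b

/-! ### Survival function for `γ = 0` -/

section Driftless

theorem isSurvivalFunction_half : IsSurvivalFunction (fun t => 1 / 2 + 1 / 2 * (1 + t)⁻¹)
    (fun t => 1 / 2 * (1 / (1 + t) ^ 2)) (1 / 2) where
  hasDerivAt t ht := by
    have := ((((hasDerivAt_id' t).const_add 1).fun_inv
      (by positivity)).const_mul (1 / 2)).const_add (1 / 2)
    exact this.congr_deriv (by ring)
  nonneg t ht := by positivity
  measurable := by fun_prop
  continuousOn := by
    intro t ht
    have ht : (0 : ℝ) ≤ t := ht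
    refine ContinuousAt.continuousWithinAt ?_
    have : (1 + t) ^ 2 ≠ 0 := by positivity
    fun_prop (disch := assumption)
  zero := by norm_num
  const_nonneg := by norm_num
  tendsto := by
    have : Tendsto (fun t : ℝ => (1 + t)⁻¹) atTop (𝓝 0) :=
      tendsto_inv_atTop_zero.comp (tendsto_atTop_add_const_left _ 1 tendsto_id)
    have := (this.const_mul (1 / 2)).const_add (1 / 2)
    rwa [mul_zero, add_zero] at this

end Driftless

/-! ### Clock and inequalities for `γ > 0` -/

section Drift

/-- With probability `1 / (5 * w)`, the clock `timeScale` has passed `w ≥ 1` at a finite jump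
time. -/
noncomputable def timeScale (t : ℝ) : ℝ := 1 + t + 1 / 2 * Real.log (1 + t)

theorem hasDerivAt_timeScale {t : ℝ} (ht : 0 ≤ t) :
    HasDerivAt timeScale (1 + 1 / 2 * (1 / (1 + t))) t :=
  ((hasDerivAt_id' t).const_add 1).add ((hasDerivAt_log_one_add ht).const_mul (1 / 2))

theorem le_timeScale {t : ℝ} (ht : 0 ≤ t) : 1 + t ≤ timeScale t := by
  have := Real.log_nonneg (by linarith : (1 : ℝ) ≤ 1 + t)
  rw [timeScale]; linarith

theorem timeScale_le {t : ℝ} (ht : 0 ≤ t) : timeScale t ≤ 1 + 3 / 2 * t := by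
  have := Real.log_le_sub_one_of_pos (by linarith : (0 : ℝ) < 1 + t)
  rw [timeScale]; linarith

theorem timeScale_mono {s t : ℝ} (hs : 0 ≤ s) (hst : s ≤ t) : timeScale s ≤ timeScale t := by
  have := Real.log_le_log (by linarith) (by linarith : 1 + s ≤ 1 + t)
  rw [timeScale, timeScale]; linarith

theorem timeScale_zero : timeScale 0 = 1 := by simp [timeScale]

theorem measurable_timeScale : Measurable timeScale := by
  unfold timeScale; fun_prop

theorem continuousOn_timeScale : ContinuousOn timeScale (Set.Ici 0) :=
  fun _ ht => (hasDerivAt_timeScale ht).continuousAt.continuousWithinAt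

theorem tendsto_timeScale : Tendsto timeScale atTop atTop :=
  tendsto_atTop_mono' _ (by filter_upwards [eventually_ge_atTop 0] with t ht using le_timeScale ht)
    (tendsto_atTop_add_const_left _ 1 tendsto_id)

theorem exists_timeScale_eq {w : ℝ} (hw : 1 ≤ w) : ∃ t, 0 ≤ t ∧ timeScale t = w := by
  have hsub : Set.Icc (0 : ℝ) w ⊆ Set.Ici 0 := fun _ h => h.1
  obtain ⟨t, ht, h⟩ := intermediate_value_Icc (by linarith : (0 : ℝ) ≤ w)
    (continuousOn_timeScale.mono hsub) ⟨by rwa [timeScale_zero],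
      (by linarith : w ≤ 1 + w).trans (le_timeScale (by linarith))⟩
  exact ⟨t, ht.1, h⟩

theorem isSurvivalFunction_timeScale : IsSurvivalFunction
    (fun t => 4 / 5 + 1 / 5 * (timeScale t)⁻¹)
    (fun t => 1 / 5 * ((1 + 1 / 2 * (1 / (1 + t))) / timeScale t ^ 2)) (4 / 5) where
  hasDerivAt t ht := by
    have hw : timeScale t ≠ 0 := by linarith [le_timeScale ht]
    have := (((hasDerivAt_timeScale ht).fun_inv hw).const_mul (1 / 5)).const_add (4 / 5)
    exact this.congr_deriv (by ring)
  nonneg t ht := by positivity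
  measurable := by
    have := measurable_timeScale
    fun_prop
  continuousOn := by
    intro t ht
    have ht : (0 : ℝ) ≤ t := ht
    have hw : timeScale t ^ 2 ≠ 0 := pow_ne_zero _ (by linarith [le_timeScale ht])
    have h1 : 1 + t ≠ 0 := by positivity
    have := (hasDerivAt_timeScale ht).continuousAt
    refine ContinuousAt.continuousWithinAt ?_
    fun_prop (disch := assumption)
  zero := by rw [timeScale_zero]; norm_num
  const_nonneg := by norm_num
  tendsto := by
    have := ((tendsto_inv_atTop_zero.comp tendsto_timeScale).const_mul (1 / 5)).const_add
      (4 / 5 : ℝ)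
    rwa [mul_zero, add_zero] at this

/-- With `w` the clock and `1 + t ≤ w`, clearing denominators leaves `(2w - 2)(2w + 1) ≤ 4w² + w`.
-/
theorem drift_timeScale_le {t : ℝ} (ht : 0 ≤ t) :
    -(1 / 2) * (1 / (1 + t)) * (4 / 5 + 1 / 5 * (timeScale t)⁻¹)
      + (2 * timeScale t - 2) * (1 / 5 * ((1 + 1 / 2 * (1 / (1 + t))) / timeScale t ^ 2)) ≤ 0 := by
  have h1 := le_timeScale ht
  set w := timeScale t
  have hw : 0 < w := by linarith
  have e : -(1 / 2) * (1 / (1 + t)) * (4 / 5 + 1 / 5 * w⁻¹)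
      + (2 * w - 2) * (1 / 5 * ((1 + 1 / 2 * (1 / (1 + t))) / w ^ 2))
      = -((4 * w ^ 2 + w) - (2 * w - 2) * (2 * (1 + t) + 1)) / (10 * (1 + t) * w ^ 2) := by
    field_simp
    ring
  rw [e]
  refine div_nonpos_of_nonpos_of_nonneg ?_ (by positivity)
  nlinarith

/-- The leading terms `8 (1 + t) w²` cancel, leaving `4 (w - 1)² ≤ (1 + t)(18 w - 8)`; this holds
since `w - 1` is at most `3/2 * t`. -/
theorem variance_timeScale_le {t : ℝ} (ht : 0 ≤ t) :
    (2 * timeScale t - 2) ^ 2 * (1 / 5 * ((1 + 1 / 2 * (1 / (1 + t))) / timeScale t ^ 2))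
      ≤ 4 / 5 + 1 / 5 * (timeScale t)⁻¹ := by
  have h1 := le_timeScale ht
  have h2 := timeScale_le ht
  set w := timeScale t
  have hw : 0 < w := by linarith
  rw [← sub_nonneg]
  have e : 4 / 5 + 1 / 5 * w⁻¹
      - (2 * w - 2) ^ 2 * (1 / 5 * ((1 + 1 / 2 * (1 / (1 + t))) / w ^ 2))
      = (2 * (1 + t) * (4 * w ^ 2 + w) - 4 * (w - 1) ^ 2 * (2 * (1 + t) + 1))
        / (10 * (1 + t) * w ^ 2) := by
    field_simp
    ring
  rw [e]
  refine div_nonneg ?_ (by positivity)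
  nlinarith [mul_nonneg (sub_nonneg.2 h1) (sub_nonneg.2 h2), mul_nonneg ht ht]

end Drift

/-! ### The two examples and the theorem -/

/-- A martingale that grows logarithmically until a time that is infinite with probability `1 / 2`
and jumps down at that time. -/
theorem exists_timedDriftDown_zero : ∃ (Ω : Type) (m : MeasurableSpace Ω) (P : Measure Ω)
    (𝓕 : Filtration ℝ≥0 m) (Y : ℝ≥0 → Ω → ℝ),
      IsProbabilityMeasure P ∧ UsualConditions 𝓕 P ∧ TimedDriftDown Y 0 𝓕 P ∧
      ∀ a : ℝ, 0 ≤ a → ∃ E, MeasurableSet E ∧ (∀ ω ∈ E, (a : EReal) ≤ pathSup Y ω) ∧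
        1 / (5 * (1 + 0 * a)) ≤ P.real E := by
  have h := isSurvivalFunction_half
  refine ⟨_, _, _, jumpFiltration _ _,
    -- The jump is `-F' S / g`, which makes the drift condition an equality.
    singleJump (fun t => 1 / 2 * Real.log (1 + t)) (fun t => -((2 + t) / 2)) 0,
    isProbabilityMeasure_completion h, usualConditions_jumpFiltration _ _,
    timedDriftDown_singleJump h (by fun_prop) (lipschitzOnWith_const_mul_log_one_add _) (by simp)
      (fun t ht => hasDerivAt_const_mul_log_one_add _ ht) (by fun_prop) (by fun_prop) le_rfl
      one_pos (by simp) (fun t ht => ?_) (fun t ht => ?_),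
    -- The point `0` stands for an infinite time and has mass `1/2`; there the path exceeds `a` at
    -- time `exp (2 * a)`.
    fun a ha => exists_measurableSet_le_pathSup (measurableSet_singleton 0)
      (fun x hx => ⟨NNReal.mk (Real.exp (2 * a)) (Real.exp_pos _).le, ?_⟩) ?_⟩
  · refine le_of_eq ?_
    field_simp
    ring
  · rw [← sub_nonneg]
    have e : 1 * (1 / 2 + 1 / 2 * (1 + t)⁻¹)
        - (-((2 + t) / 2)) ^ 2 * (1 / 2 * (1 / (1 + t) ^ 2))
        = (2 + t) * (2 + 3 * t) / (8 * (1 + t) ^ 2) := by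
      field_simp
      ring
    rw [e]
    positivity
  · obtain rfl : x = 0 := hx
    refine le_of_le_of_eq ?_ (singleJump_of_mem_notYet fun h => lt_irrefl _ h.1).symm
    have := Real.log_le_log (Real.exp_pos (2 * a))
      (by linarith : Real.exp (2 * a) ≤ 1 + Real.exp (2 * a))
    rw [Real.log_exp] at this
    simp only [NNReal.coe_mk, zero_mul, sub_zero]
    linarith
  · rw [measureReal_def, jumpTimeLaw_singleton_zero,
      ENNReal.toReal_ofReal (by norm_num)]
    norm_num

/-- A process that drifts down until a time that is infinite with probability `4 / 5` and jumps up
at that time, the higher the later it comes. -/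
theorem exists_timedDriftDown_pos {γ : ℝ} (hγ : 0 < γ) :
    ∃ (Ω : Type) (m : MeasurableSpace Ω) (P : Measure Ω)
    (𝓕 : Filtration ℝ≥0 m) (Y : ℝ≥0 → Ω → ℝ),
      IsProbabilityMeasure P ∧ UsualConditions 𝓕 P ∧ TimedDriftDown Y γ 𝓕 P ∧
      ∀ a : ℝ, 0 ≤ a → ∃ E, MeasurableSet E ∧ (∀ ω ∈ E, (a : EReal) ≤ pathSup Y ω) ∧
        1 / (5 * (1 + γ * a)) ≤ P.real E := by
  have h := isSurvivalFunction_timeScale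
  have hinv : 0 < γ⁻¹ := inv_pos.2 hγ
  refine ⟨_, _, _, jumpFiltration _ _,
    -- Scaling space by `γ⁻¹` gives `μ = γ⁻¹` and `σ² = γ⁻²`, so `μ / σ² = γ` and the two
    -- inequalities become those for `γ = 1`.
    singleJump (fun t => γ⁻¹ * -(1 / 2) * Real.log (1 + t))
      (fun t => γ⁻¹ * (2 * timeScale t - 2)) γ⁻¹,
    isProbabilityMeasure_completion h, usualConditions_jumpFiltration _ _,
    timedDriftDown_singleJump (σsq := γ⁻¹ ^ 2) h (by fun_prop)
      (lipschitzOnWith_const_mul_log_one_add _) (by simp)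
      (fun t ht => hasDerivAt_const_mul_log_one_add _ ht)
      (((measurable_timeScale.const_mul 2).sub_const 2).const_mul _)
      (((continuousOn_timeScale.const_mul 2).sub continuousOn_const).const_mul _) hinv.le
      (by positivity) (by field_simp) (fun t ht => ?_) (fun t ht => ?_),
    fun a ha => ?_⟩
  · have := mul_le_mul_of_nonneg_left (drift_timeScale_le ht) hinv.le
    linarith
  · have := mul_le_mul_of_nonneg_left (variance_timeScale_le ht) (sq_nonneg γ⁻¹)
    linarith
  · have hγa : 0 ≤ γ * a := by positivity
    obtain ⟨t₀, ht₀, hw⟩ := exists_timeScale_eq (by linarith : 1 ≤ 1 + γ * a)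
    refine exists_measurableSet_le_pathSup (measurableSet_Ioi (a := t₀)) (fun x hx => ?_) ?_
    · have hx : t₀ < x := hx
      have hx0 : 0 < x := ht₀.trans_lt hx
      refine ⟨NNReal.mk x hx0.le, ?_⟩
      refine le_of_le_of_eq ?_ (singleJump_of_mem ⟨hx0, le_rfl⟩).symm
      rw [NNReal.coe_mk]
      have hle := timeScale_mono ht₀ hx.le
      -- The jump `2 (w - 1) / γ` takes the path from `-(w - 1) / γ` to `(w - 1) / γ`, which is at
      -- least `a` because `w ≥ 1 + γ a` after `t₀`.
      have e : γ⁻¹ * -(1 / 2) * Real.log (1 + x) + γ⁻¹ * (2 * timeScale x - 2) - γ⁻¹ * x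
          = γ⁻¹ * (timeScale x - 1) := by
        rw [timeScale]; ring
      rw [e, ← div_eq_inv_mul, le_div_iff₀ hγ]
      linarith
    · rw [measureReal_def, jumpTimeLaw_Ioi h ht₀, hw,
        add_sub_cancel_left, ENNReal.toReal_ofReal (by positivity), ← one_div_mul_one_div,
        one_div (1 + γ * a)]

theorem proposition2 (γ : ℝ) (hγ : 0 ≤ γ) :
    ∃ (Ω : Type) (m : MeasurableSpace Ω) (P : Measure Ω) (𝓕 : Filtration ℝ≥0 m)
      (Y : ℝ≥0 → Ω → ℝ),
      IsProbabilityMeasure P ∧ UsualConditions 𝓕 P ∧ TimedDriftDown Y γ 𝓕 P ∧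
      (∀ a : ℝ, 0 ≤ a → 1 / (5 * (1 + γ * a)) ≤ P.real {ω | (a : EReal) ≤ pathSup Y ω}) ∧
      ∫⁻ ω, (pathSup Y ω).toENNReal ∂P = ⊤ := by
  obtain ⟨Ω, m, P, 𝓕, Y, hP, h𝓕, hY, hE⟩ :
      ∃ (Ω : Type) (m : MeasurableSpace Ω) (P : Measure Ω)
      (𝓕 : Filtration ℝ≥0 m) (Y : ℝ≥0 → Ω → ℝ),
        IsProbabilityMeasure P ∧ UsualConditions 𝓕 P ∧ TimedDriftDown Y γ 𝓕 P ∧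
        ∀ a : ℝ, 0 ≤ a → ∃ E, MeasurableSet E ∧ (∀ ω ∈ E, (a : EReal) ≤ pathSup Y ω) ∧
          1 / (5 * (1 + γ * a)) ≤ P.real E := by
    rcases hγ.eq_or_lt with rfl | hγ
    · exact exists_timedDriftDown_zero
    · exact exists_timedDriftDown_pos hγ
  refine ⟨Ω, m, P, 𝓕, Y, hP, h𝓕, hY, fun a ha => ?_, lintegral_pathSup_eq_top hγ hE⟩
  obtain ⟨E, -, hEsup, hEP⟩ := hE a ha
  exact hEP.trans (measureReal_mono hEsup)
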